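/- Let $n,m\ge 1$ and let $\Psi=\{A_1,\dots,A_m\}$ be a finite set of nonnegative real $n\times n$ matrices, at least one of which is nonzero. Write $a\oplus b=\max(a,b)$ (entrywise for matrices and vectors) and $(A\otimes B)_{ij}=\max_k a_{ik}b_{kj}$, and let $S=A_1\oplus\cdots\oplus A_m$. For a nonnegative $n\times n$ matrix $A$, let $D(A)$ be the digraph with node set $N(A)=\{1,\dots,n\}$ and an edge $(i,j)$ whenever $a_{ij}>0$. A cycle of length $k\ge1$ in $D(A)$ is a closed path $i_1,i_2,\dots,i_k,i_1$ along edges with $i_1,\dots,i_k$ distinct; its geometric mean is $(a_{i_1i_2}a_{i_2i_3}\cdots a_{i_ki_1})^{1/k}$. Let $\mu(A)$ be the maximal cycle geometric mean ($0$ if there is no cycle). A cycle of $D(A)$ attaining $\mu(A)$ is critical; $N^C(A)$ is the set of nodes lying on critical cycles, and the critical matrix $A^C$ is the matrix indexed by $N^C(A)$ with entries $a^C_{ij}=a_{ij}$ if the edge $(i,j)$ lies on a critical cycle and $a^C_{ij}=0$ otherwise. A nonnegative matrix is irreducible if in its digraph every node can be reached from every other node by a directed path. For $x$ with positive entries let $e_A(x)=\max_{i,j}a_{ij}x_j/x_i$.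 For $r\in\mathbb R$ put $$\mathcal C_{\Psi,r}=\{x\in\mathbb R^n: x_i>0 \text{ for all } i,\ e_{A_l}(x)\le r \text{ for } l=1,\dots,m\},\qquad \mathcal D_{\Psi,r}=\{x\in\mathcal C_{\Psi,r}: x_1=1\},$$ and let $\mathcal D_\Psi=\mathcal D_{\Psi,\hat\mu(\Psi)}$, where $$\hat\mu(\Psi)=\limsup_{p\to\infty}\Big(\max_{1\le j_1,\dots,j_p\le m}\mu(A_{j_1}\otimes\cdots\otimes A_{j_p})\Big)^{1/p}.$$ A set $X$ is max-convex if $\alpha x\oplus\beta y\in X$ for all $x,y\in X$ and all $\alpha,\beta\ge0$ with $\max(\alpha,\beta)=1$. Then: (i) for every $r$, the sets $\mathcal C_{\Psi,r}$ and $\mathcal D_{\Psi,r}$ are convex and max-convex; (ii) $\mathcal D_\Psi$ consists of exactly one vector if and only if $S^C$ is irreducible and $N^C(S)=N(S)$; (iii) if all the matrices $A_1,\dots,A_m$ are irreducible, then $\mathcal D_{\Psi,r}$ is compact for every $r$. -/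

import Mathlib

namespace MaxAlg

noncomputable section

/-- The max-algebraic product of square matrices: `(A ⊗ B) i j = max_k a_{ik} b_{kj}`. -/
def maxMul {n : ℕ} (A B : Matrix (Fin n) (Fin n) ℝ) : Matrix (Fin n) (Fin n) ℝ :=
  Matrix.of fun i j => ⨆ k, A i k * B k j

/-- The max-algebraic product `A₁ ⊗ ⋯ ⊗ A_p` of a list of nonnegative matrices; the identity
matrix is neutral for `⊗` on nonnegative matrices. -/
def maxProd {n : ℕ} (L : List (Matrix (Fin n) (Fin n) ℝ)) : Matrix (Fin n) (Fin n) ℝ :=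
  L.foldr maxMul 1

/-- `c 0, c 1, …, c k, c 0` is a cycle of length `k + 1` in the digraph of `A`: the nodes are
distinct and all consecutive pairs are edges. Addition on `Fin (k + 1)` is cyclic, so `t + 1` is
the index following `t`; for `k = 0` the cycle is a loop. -/
def IsCycle {n : ℕ} (A : Matrix (Fin n) (Fin n) ℝ) {k : ℕ} (c : Fin (k + 1) → Fin n) : Prop :=
  Function.Injective c ∧ ∀ t, 0 < A (c t) (c (t + 1))

/-- The cycle geometric mean: the root, of order the length, of the weight of the cycle. -/
def cycleMean {n : ℕ} (A : Matrix (Fin n) (Fin n) ℝ) {k : ℕ} (c : Fin (k + 1) → Fin n) : ℝ :=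
  (∏ t, A (c t) (c (t + 1))) ^ (1 / ((k : ℝ) + 1))

/-- `μ(A)`: the maximal cycle geometric mean. There are finitely many cycles, so the supremum is
a maximum; it is `0` if there is no cycle. -/
def mu {n : ℕ} (A : Matrix (Fin n) (Fin n) ℝ) : ℝ :=
  sSup {g | ∃ (k : ℕ) (c : Fin (k + 1) → Fin n), IsCycle A c ∧ g = cycleMean A c}

/-- A critical cycle: a cycle whose geometric mean is maximal. -/
def IsCriticalCycle {n : ℕ} (A : Matrix (Fin n) (Fin n) ℝ) {k : ℕ}
    (c : Fin (k + 1) → Fin n) : Prop :=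
  IsCycle A c ∧ cycleMean A c = mu A

/-- `N^C(A)`: the nodes lying on some critical cycle. -/
def criticalNodes {n : ℕ} (A : Matrix (Fin n) (Fin n) ℝ) : Set (Fin n) :=
  {i | ∃ (k : ℕ) (c : Fin (k + 1) → Fin n), IsCriticalCycle A c ∧ ∃ t, c t = i}

/-- `(i, j) ∈ E^C(A)`: the edge `(i, j)` belongs to some critical cycle. -/
def IsCriticalEdge {n : ℕ} (A : Matrix (Fin n) (Fin n) ℝ) (i j : Fin n) : Prop :=
  ∃ (k : ℕ) (c : Fin (k + 1) → Fin n), IsCriticalCycle A c ∧ ∃ t, c t = i ∧ c (t + 1) = j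

open Classical in
/-- The critical matrix `A^C`, with rows and columns indexed by the critical nodes. -/
def criticalMatrix {n : ℕ} (A : Matrix (Fin n) (Fin n) ℝ) :
    Matrix (criticalNodes A) (criticalNodes A) ℝ :=
  Matrix.of fun i j => if IsCriticalEdge A i j then A i j else 0

/-- Irreducibility of a nonnegative matrix: any node can be reached from any other node along
edges `(i, j)` with `a_{ij} > 0`. It differs from `Matrix.IsIrreducible` only in that the
`1 × 1` zero matrix is irreducible here, as is usual for `1 × 1` matrices. -/
def IsIrred {ι : Type*} (A : Matrix ι ι ℝ) : Prop :=
  ∀ i j, Relation.ReflTransGen (fun a b => 0 < A a b) i j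

/-- The error function `e_A(x) = max_{i,j} a_{ij} x_j / x_i`. -/
def err {n : ℕ} (A : Matrix (Fin n) (Fin n) ℝ) (x : Fin n → ℝ) : ℝ :=
  ⨆ p : Fin n × Fin n, A p.1 p.2 * x p.2 / x p.1

/-- `S = A₁ ⊕ ⋯ ⊕ A_m`, the entrywise maximum. -/
def maxSum {n m : ℕ} (A : Fin m → Matrix (Fin n) (Fin n) ℝ) : Matrix (Fin n) (Fin n) ℝ :=
  Matrix.of fun i j => ⨆ l, A l i j

/-- The max version of the generalised spectral radius of `Ψ = {A₁, …, A_m}`: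
`limsup_{p → ∞} (max μ(A_{j₁} ⊗ ⋯ ⊗ A_{j_p})) ^ (1 / p)`, the maximum being over all words of
length `p`. -/
def muHat {n m : ℕ} (A : Fin m → Matrix (Fin n) (Fin n) ℝ) : ℝ :=
  Filter.limsup
    (fun p : ℕ =>
      (⨆ j : Fin p → Fin m, mu (maxProd (List.ofFn fun t => A (j t)))) ^ (1 / (p : ℝ)))
    Filter.atTop

/-- `C_{Ψ,r}`: the positive vectors `x` with `e_{A_l}(x) ≤ r` for all `l`. -/
def setC {n m : ℕ} (A : Fin m → Matrix (Fin n) (Fin n) ℝ) (r : ℝ) : Set (Fin n → ℝ) :=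
  {x | (∀ i, 0 < x i) ∧ ∀ l, err (A l) x ≤ r}

/-- `D_{Ψ,r}`: the vectors of `C_{Ψ,r}` whose first entry is `1`. -/
def setD {n m : ℕ} [NeZero n] (A : Fin m → Matrix (Fin n) (Fin n) ℝ) (r : ℝ) :
    Set (Fin n → ℝ) :=
  {x | x ∈ setC A r ∧ x 0 = 1}

/-- Max-convexity: `αx ⊕ βy ∈ X` whenever `x, y ∈ X`, `α, β ≥ 0` and `max(α, β) = 1`. -/
def MaxConvex {n : ℕ} (X : Set (Fin n → ℝ)) : Prop :=
  ∀ x ∈ X, ∀ y ∈ X, ∀ α β : ℝ, 0 ≤ α → 0 ≤ β → max α β = 1 →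
    (fun i => max (α * x i) (β * y i)) ∈ X

end

end MaxAlg

namespace MaxAlg

open Filter Topology

/-! For positive `x`, all conditions `e_{A_l}(x) ≤ r` together say that `x` is a subeigenvector of
`S` for `r`. These inequalities are linear in `x` and also respect maxima, whence (i). Along a path
of positive entries they bound ratios of coordinates, so an irreducible matrix confines the
normalised `x` to a box away from zero, whence (iii).

For (ii), call an edge tight if its inequality is an equality. Multiplying round a cycle cancels
`x`: for `r = μ(S)` critical edges are tight for every positive subeigenvector
(`eq_of_isCriticalEdge`), and conversely a cycle of tight edges is critical (`isCriticalCycle`). If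
critical edges connect all nodes, they determine `x` up to scaling; existence comes from maximal
path weights, and `muHat_eq_mu` identifies the radius with `μ(S)`. If instead `x` is unique, tight
edges must connect all nodes (`tight_connected`), since otherwise the unreachable coordinates could
be raised slightly; each tight edge then lies on a critical cycle. -/

/-- `x` is a subeigenvector of `S` for `r`: `s_{ij} x_j ≤ r x_i` for all `i`, `j`. -/
def IsSubeigenvector {n : ℕ} (S : Matrix (Fin n) (Fin n) ℝ) (r : ℝ) (x : Fin n → ℝ) : Prop :=
  ∀ i j, S i j * x j ≤ r * x i

/-! ### Subeigenvectors and the two convexities -/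

section Basic

variable {n m : ℕ}

lemma err_le_iff [NeZero n] {S : Matrix (Fin n) (Fin n) ℝ} {x : Fin n → ℝ} {r : ℝ}
    (hx : ∀ i, 0 < x i) : err S x ≤ r ↔ IsSubeigenvector S r x := by
  unfold err
  rw [ciSup_le_iff (Set.finite_range _).bddAbove]
  constructor
  · intro h i j
    exact (div_le_iff₀ (hx i)).1 (h (i, j))
  · rintro h ⟨i, j⟩
    exact (div_le_iff₀ (hx i)).2 (h i j)

lemma le_maxSum (A : Fin m → Matrix (Fin n) (Fin n) ℝ) (l : Fin m) (i j : Fin n) :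
    A l i j ≤ maxSum A i j :=
  le_ciSup (f := fun l => A l i j) (Set.finite_range _).bddAbove l

lemma exists_eq_maxSum [Nonempty (Fin m)] (A : Fin m → Matrix (Fin n) (Fin n) ℝ) (i j : Fin n) :
    ∃ l, A l i j = maxSum A i j :=
  exists_eq_ciSup_of_finite (f := fun l => A l i j)

lemma isSubeigenvector_maxSum_iff [Nonempty (Fin m)] {A : Fin m → Matrix (Fin n) (Fin n) ℝ}
    {x : Fin n → ℝ} {r : ℝ} (hx : ∀ i, 0 < x i) :
    IsSubeigenvector (maxSum A) r x ↔ ∀ l, IsSubeigenvector (A l) r x := by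
  constructor
  · intro h l i j
    exact (mul_le_mul_of_nonneg_right (le_maxSum A l i j) (hx j).le).trans (h i j)
  · intro h i j
    obtain ⟨l, hl⟩ := exists_eq_maxSum A i j
    rw [← hl]
    exact h l i j

lemma mem_setC_iff [NeZero n] {A : Fin m → Matrix (Fin n) (Fin n) ℝ} {x : Fin n → ℝ} {r : ℝ} :
    x ∈ setC A r ↔ (∀ i, 0 < x i) ∧ ∀ l, IsSubeigenvector (A l) r x :=
  and_congr_right fun hx => forall_congr' fun _ => err_le_iff hx

lemma mem_setC_iff_maxSum [NeZero n] [Nonempty (Fin m)] {A : Fin m → Matrix (Fin n) (Fin n) ℝ}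
    {x : Fin n → ℝ} {r : ℝ} :
    x ∈ setC A r ↔ (∀ i, 0 < x i) ∧ IsSubeigenvector (maxSum A) r x := by
  rw [mem_setC_iff]
  exact and_congr_right fun hx => (isSubeigenvector_maxSum_iff hx).symm

lemma IsSubeigenvector.smul {S : Matrix (Fin n) (Fin n) ℝ} {r : ℝ} {x : Fin n → ℝ}
    (h : IsSubeigenvector S r x) {a : ℝ} (ha : 0 ≤ a) :
    IsSubeigenvector S r (fun i => a * x i) := by
  intro i j
  have := mul_le_mul_of_nonneg_left (h i j) ha
  linarith

lemma convex_setC [NeZero n] (A : Fin m → Matrix (Fin n) (Fin n) ℝ) (r : ℝ) :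
    Convex ℝ (setC A r) := by
  intro x hx y hy a b ha hb hab
  rw [mem_setC_iff] at *
  refine ⟨fun i => ?_, fun l i j => ?_⟩
  · exact (convex_Ioi (0 : ℝ)) (hx.1 i) (hy.1 i) ha hb hab
  · have h₁ := mul_le_mul_of_nonneg_left (hx.2 l i j) ha
    have h₂ := mul_le_mul_of_nonneg_left (hy.2 l i j) hb
    simp only [Pi.add_apply, Pi.smul_apply, smul_eq_mul]
    linarith

lemma convex_setD [NeZero n] (A : Fin m → Matrix (Fin n) (Fin n) ℝ) (r : ℝ) :
    Convex ℝ (setD A r) := by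
  intro x hx y hy a b ha hb hab
  refine ⟨convex_setC A r hx.1 hy.1 ha hb hab, ?_⟩
  simp [hx.2, hy.2, hab]

lemma maxConvex_setC [NeZero n] {A : Fin m → Matrix (Fin n) (Fin n) ℝ}
    (hA : ∀ l i j, 0 ≤ A l i j) (r : ℝ) : MaxConvex (setC A r) := by
  intro x hx y hy a b ha hb hab
  rw [mem_setC_iff] at *
  refine ⟨fun i => ?_, fun l i j => ?_⟩
  · rcases max_choice a b with h | h
    · exact lt_max_of_lt_left (mul_pos (by linarith) (hx.1 i))
    · exact lt_max_of_lt_right (mul_pos (by linarith) (hy.1 i))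
  · have hr : 0 ≤ r := by
      have := (mul_nonneg (hA l i j) (hx.1 j).le).trans (hx.2 l i j)
      exact nonneg_of_mul_nonneg_left this (hx.1 i)
    change A l i j * max (a * x j) (b * y j) ≤ r * max (a * x i) (b * y i)
    rw [mul_max_of_nonneg _ _ (hA l i j), mul_max_of_nonneg _ _ hr]
    exact max_le_max ((hx.2 l).smul ha i j) ((hy.2 l).smul hb i j)

lemma maxConvex_setD [NeZero n] {A : Fin m → Matrix (Fin n) (Fin n) ℝ}
    (hA : ∀ l i j, 0 ≤ A l i j) (r : ℝ) : MaxConvex (setD A r) := by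
  intro x hx y hy a b ha hb hab
  refine ⟨maxConvex_setC hA r x hx.1 y hy.1 a b ha hb hab, ?_⟩
  simp [hx.2, hy.2, hab]

end Basic

/-! ### Compactness from irreducibility -/

section Compact

variable {n m : ℕ}

/-- Each edge of the path bounds one coordinate by a multiple of the previous one; the multiples are
independent of `x`. -/
lemma exists_bound_of_reachable {S : Matrix (Fin n) (Fin n) ℝ} (r : ℝ) {i j : Fin n}
    (h : Relation.ReflTransGen (fun a b => 0 < S a b) i j) :
    ∃ C : ℝ, 0 < C ∧ ∀ x : Fin n → ℝ, (∀ i, 0 < x i) → IsSubeigenvector S r x →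
      x j ≤ C * x i := by
  induction h with
  | refl => exact ⟨1, one_pos, fun x _ _ => by simp⟩
  | @tail b c _ hbc ih =>
    obtain ⟨C, hC, hb⟩ := ih
    -- `|r| + 1` replaces `r` to keep the constant positive whatever the sign of `r`.
    have hk : 0 < (|r| + 1) / S b c := by positivity
    refine ⟨(|r| + 1) / S b c * C, by positivity, fun x hx hs => ?_⟩
    have h₁ : x c ≤ (|r| + 1) / S b c * x b := by
      rw [div_mul_eq_mul_div, le_div_iff₀ hbc]
      have := hs b c
      nlinarith [le_abs_self r, hx b, hx c]
    calc x c ≤ (|r| + 1) / S b c * x b := h₁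
      _ ≤ (|r| + 1) / S b c * (C * x i) := mul_le_mul_of_nonneg_left (hb x hx hs) hk.le
      _ = _ := by ring

lemma isCompact_setD [NeZero n] {A : Fin m → Matrix (Fin n) (Fin n) ℝ} {l : Fin m}
    (hl : IsIrred (A l)) (r : ℝ) : IsCompact (setD A r) := by
  choose C hC hCx using fun i => exists_bound_of_reachable r (hl 0 i)
  choose C' hC' hCx' using fun i => exists_bound_of_reachable r (hl i 0)
  have heq : setD A r = Set.Icc (fun i => (C' i)⁻¹) C ∩
      ({x | x 0 = 1} ∩ ⋂ l, ⋂ i, ⋂ j, {x | A l i j * x j ≤ r * x i}) := by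
    ext x
    simp only [setD, Set.mem_ofPred_eq, mem_setC_iff, Set.mem_inter_iff, Set.mem_Icc,
      Set.mem_iInter]
    constructor
    · rintro ⟨⟨hx, hs⟩, h0⟩
      refine ⟨⟨fun i => ?_, fun i => ?_⟩, h0, hs⟩
      · have := hCx' i x hx (hs l)
        rw [h0] at this
        exact (inv_le_iff_one_le_mul₀' (hC' i)).2 this
      · simpa [h0] using hCx i x hx (hs l)
    · rintro ⟨⟨hx, _⟩, h0, hs⟩
      exact ⟨⟨fun i => (inv_pos.2 (hC' i)).trans_le (hx i), hs⟩, h0⟩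
  rw [heq]
  refine isCompact_Icc.inter_right (IsClosed.inter ?_ ?_)
  · exact isClosed_eq (by fun_prop) (by fun_prop)
  · refine isClosed_iInter fun l => isClosed_iInter fun i => isClosed_iInter fun j => ?_
    exact isClosed_le (by fun_prop) (by fun_prop)

end Compact

/-! ### Cycle means, tight edges and critical cycles -/

section Cycles

variable {n : ℕ} {S : Matrix (Fin n) (Fin n) ℝ} {r : ℝ} {x : Fin n → ℝ}

lemma prod_cycle_ratio (hx : ∀ i, 0 < x i) {k : ℕ} (c : Fin (k + 1) → Fin n) :
    ∏ t, r * x (c t) / x (c (t + 1)) = r ^ (k + 1) := by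
  have h : ∏ t, x (c (t + 1)) = ∏ t, x (c t) :=
    Fintype.prod_equiv (Equiv.addRight (1 : Fin (k + 1))) _ _ fun _ => rfl
  have hne : ∏ t, x (c t) ≠ 0 := Finset.prod_ne_zero_iff.2 fun t _ => (hx _).ne'
  rw [Finset.prod_div_distrib, Finset.prod_mul_distrib, h, mul_div_assoc, div_self hne]
  simp

lemma cycleMean_pow {k : ℕ} {c : Fin (k + 1) → Fin n} (hc : IsCycle S c) :
    cycleMean S c ^ (k + 1) = ∏ t, S (c t) (c (t + 1)) := by
  have h0 : 0 ≤ ∏ t, S (c t) (c (t + 1)) := Finset.prod_nonneg fun t _ => (hc.2 t).le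
  unfold cycleMean
  rw [one_div, ← Nat.cast_succ, Real.rpow_inv_natCast_pow h0 (by simp)]

lemma cycleMean_pos {k : ℕ} {c : Fin (k + 1) → Fin n} (hc : IsCycle S c) :
    0 < cycleMean S c :=
  Real.rpow_pos_of_pos (Finset.prod_pos fun t _ => hc.2 t) _

lemma IsSubeigenvector.cycleMean_le (hs : IsSubeigenvector S r x) (hx : ∀ i, 0 < x i)
    (hr : 0 ≤ r) {k : ℕ} {c : Fin (k + 1) → Fin n} (hc : IsCycle S c) : cycleMean S c ≤ r := by
  refine le_of_pow_le_pow_left₀ (Nat.succ_ne_zero k) hr ?_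
  rw [cycleMean_pow hc, ← prod_cycle_ratio hx c]
  exact Finset.prod_le_prod (fun t _ => (hc.2 t).le)
    fun t _ => (le_div_iff₀ (hx _)).2 (hs _ _)

lemma IsSubeigenvector.mu_le (hs : IsSubeigenvector S r x) (hx : ∀ i, 0 < x i)
    (hr : 0 ≤ r) : mu S ≤ r := by
  refine Real.sSup_le ?_ hr
  rintro _ ⟨k, c, hc, rfl⟩
  exact hs.cycleMean_le hx hr hc

/-- Supplies a common bound on cycle means, so that the supremum defining `mu` is not the default
value of an unbounded set. -/
lemma exists_isSubeigenvector_one (hS : ∀ i j, 0 ≤ S i j) :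
    ∃ M : ℝ, 0 ≤ M ∧ IsSubeigenvector S M (fun _ => 1) := by
  refine ⟨∑ i, ∑ j, S i j, Finset.sum_nonneg fun i _ => Finset.sum_nonneg fun j _ => hS i j, ?_⟩
  intro i j
  rw [mul_one, mul_one]
  calc S i j ≤ ∑ j, S i j :=
        Finset.single_le_sum (f := fun j => S i j) (fun j _ => hS i j) (Finset.mem_univ j)
    _ ≤ _ := Finset.single_le_sum (f := fun i => ∑ j, S i j)
        (fun i _ => Finset.sum_nonneg fun j _ => hS i j) (Finset.mem_univ i)

lemma cycleMean_le_mu (hS : ∀ i j, 0 ≤ S i j) {k : ℕ} {c : Fin (k + 1) → Fin n}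
    (hc : IsCycle S c) : cycleMean S c ≤ mu S := by
  obtain ⟨M, hM, hs⟩ := exists_isSubeigenvector_one hS
  refine le_csSup ⟨M, ?_⟩ ⟨k, c, hc, rfl⟩
  rintro _ ⟨k, c, hc, rfl⟩
  exact hs.cycleMean_le (fun _ => one_pos) hM hc

lemma diag_le_mu (hS : ∀ i j, 0 ≤ S i j) (i : Fin n) : S i i ≤ mu S := by
  rcases (hS i i).eq_or_lt with h | h
  · rw [← h]
    refine Real.sSup_nonneg ?_
    rintro _ ⟨k, c, hc, rfl⟩
    exact (cycleMean_pos hc).le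
  · have hc : IsCycle S (k := 0) (fun _ => i) := ⟨fun _ _ _ => Fin.ext (by omega), fun _ => h⟩
    have := cycleMean_le_mu hS hc
    simpa [cycleMean] using this

/-- Both sides of the inequalities have the same product round a critical cycle, so none of them can
be strict. -/
lemma IsSubeigenvector.eq_of_isCriticalEdge (hs : IsSubeigenvector S (mu S) x)
    (hx : ∀ i, 0 < x i) {i j : Fin n} (h : IsCriticalEdge S i j) :
    S i j * x j = mu S * x i := by
  obtain ⟨k, c, ⟨hc, hcm⟩, t, rfl, rfl⟩ := h
  by_contra hne
  have hlt := lt_of_le_of_ne (hs (c t) (c (t + 1))) hne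
  have : ∏ t, S (c t) (c (t + 1)) < ∏ t, mu S * x (c t) / x (c (t + 1)) :=
    Finset.prod_lt_prod (fun t _ => hc.2 t) (fun t _ => (le_div_iff₀ (hx _)).2 (hs _ _))
      ⟨t, Finset.mem_univ t, (lt_div_iff₀ (hx _)).2 hlt⟩
  rw [prod_cycle_ratio hx, ← cycleMean_pow hc, hcm] at this
  exact this.false

/-- A cycle all of whose edges are tight for a positive subeigenvector is critical. -/
lemma IsSubeigenvector.isCriticalCycle (hS : ∀ i j, 0 ≤ S i j) (hs : IsSubeigenvector S r x)
    (hx : ∀ i, 0 < x i) (hr : 0 < r) {k : ℕ} {c : Fin (k + 1) → Fin n}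
    (hinj : Function.Injective c)
    (hc : ∀ t, S (c t) (c (t + 1)) * x (c (t + 1)) = r * x (c t)) : IsCriticalCycle S c := by
  have hcyc : IsCycle S c := by
    refine ⟨hinj, fun t => pos_of_mul_pos_left ?_ (hx (c (t + 1))).le⟩
    rw [hc t]
    exact mul_pos hr (hx _)
  have hmean : cycleMean S c = r := by
    refine (pow_left_inj₀ (cycleMean_pos hcyc).le hr.le (Nat.succ_ne_zero k)).1 ?_
    rw [cycleMean_pow hcyc, ← prod_cycle_ratio hx c]
    exact Finset.prod_congr rfl fun t _ => (eq_div_iff (hx _).ne').2 (hc t)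
  refine ⟨hcyc, le_antisymm (cycleMean_le_mu hS hcyc) ?_⟩
  rw [hmean]
  exact hs.mu_le hx hr.le

/-- A closed walk along a relation, given by an edge and a path back, can be shortened to a cycle
through that edge. -/
lemma exists_cycle_of_reachable {R : Fin n → Fin n → Prop} {i j : Fin n} (hij : R i j)
    (hji : Relation.ReflTransGen R j i) :
    ∃ (k : ℕ) (c : Fin (k + 1) → Fin n), Function.Injective c ∧ (∀ t, R (c t) (c (t + 1))) ∧
      ∃ t, c t = i ∧ c (t + 1) = j := by
  classical
  have hex : ∃ k, ∃ p : ℕ → Fin n, p 0 = j ∧ p k = i ∧ ∀ s < k, R (p s) (p (s + 1)) := by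
    clear hij
    induction hji with
    | refl => exact ⟨0, fun _ => j, rfl, rfl, by simp⟩
    | @tail b c _ hbc ih =>
      obtain ⟨k, p, h0, hk, hp⟩ := ih
      refine ⟨k + 1, fun s => if s ≤ k then p s else c, by simp [h0], by simp, fun s hs => ?_⟩
      rcases (Nat.lt_succ_iff.1 hs).eq_or_lt with rfl | h
      · simpa [hk] using hbc
      · simpa [h.le, Nat.succ_le_iff.2 h] using hp s h
  obtain ⟨p, h0, hk, hp⟩ := Nat.find_spec hex
  set k := Nat.find hex with hkdef
  -- A shortest path from `j` to `i` is simple: cutting out the part between two visits to a node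
  -- would shorten it.
  have hinj : ∀ a b, a < b → b ≤ k → p a ≠ p b := by
    intro a b hab hbk he
    refine Nat.find_min hex (m := k - (b - a)) (by omega)
      ⟨fun s => if s ≤ a then p s else p (s + (b - a)), by simp [h0], ?_, fun s hs => ?_⟩
    · by_cases h : k - (b - a) ≤ a
      · have hb : b = k := by omega
        have : k - (b - a) = a := by omega
        change (if _ ≤ a then _ else _) = i
        rw [if_pos h, this, he, hb, hk]
      · have : k - (b - a) + (b - a) = k := by omega
        simp [h, this, hk]
    · rcases lt_trichotomy s a with h | rfl | h
      · simpa [h.le, Nat.succ_le_iff.2 h] using hp s (by omega)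
      · have h1 : s + 1 + (b - s) = b + 1 := by omega
        simpa [h1, he] using hp b (by omega)
      · have h1 : s + 1 + (b - a) = s + (b - a) + 1 := by omega
        simpa [h.not_ge, (h.trans (Nat.lt_succ_self s)).not_ge, h1] using
          hp (s + (b - a)) (by omega)
  refine ⟨k, fun s => p s, ?_, fun t => ?_, Fin.last k, by simpa using hk, by simpa using h0⟩
  · intro a b hab
    by_contra hne
    rcases lt_or_gt_of_ne hne with h | h
    · exact hinj a b h (by omega) hab
    · exact hinj b a h (by omega) hab.symm
  · induction t using Fin.lastCases with
    | last => simpa [hk, h0] using hij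
    | cast t =>
      simpa [Fin.coeSucc_eq_succ] using hp t t.2

/-- If the tight edges of a positive subeigenvector form a strongly connected digraph with an edge
out of every node, then `S^C` is irreducible and all nodes are critical. -/
lemma IsSubeigenvector.irred_criticalMatrix (hS : ∀ i j, 0 ≤ S i j)
    (hs : IsSubeigenvector S r x) (hx : ∀ i, 0 < x i) (hr : 0 < r)
    (hconn : ∀ i j, Relation.ReflTransGen (fun a b => S a b * x b = r * x a) i j)
    (hout : ∀ i, ∃ j, S i j * x j = r * x i) :
    IsIrred (criticalMatrix S) ∧ criticalNodes S = Set.univ := by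
  have hedge : ∀ a b, S a b * x b = r * x a → IsCriticalEdge S a b := by
    intro a b hab
    obtain ⟨k, c, hinj, hc, ht⟩ := exists_cycle_of_reachable hab (hconn b a)
    exact ⟨k, c, hs.isCriticalCycle hS hx hr hinj hc, ht⟩
  have hnode : ∀ i, i ∈ criticalNodes S := by
    intro i
    obtain ⟨j, hj⟩ := hout i
    obtain ⟨k, c, hc, t, ht, -⟩ := hedge i j hj
    exact ⟨k, c, hc, t, ht⟩
  refine ⟨fun i j => ?_, Set.eq_univ_of_forall hnode⟩
  refine (hconn i j).lift (fun a => (⟨a, hnode a⟩ : criticalNodes S)) fun a b hab => ?_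
  have hpos : 0 < S a b := by
    refine pos_of_mul_pos_left ?_ (hx b).le
    rw [hab]
    exact mul_pos hr (hx a)
  simpa [Function.onFun, criticalMatrix, hedge a b hab] using hpos

end Cycles


/-! ### Positive subeigenvectors from maximal path weights -/

section Existence

variable {n : ℕ} {S : Matrix (Fin n) (Fin n) ℝ} {r : ℝ}

lemma prod_simple_closed_walk_le (hS : ∀ i j, 0 ≤ S i j) (hr : mu S ≤ r) {p : ℕ → Fin n} {t : ℕ}
    (hp : Set.InjOn p (Set.Iic t)) :
    (∏ s ∈ Finset.range t, S (p s) (p (s + 1))) * S (p t) (p 0) ≤ r ^ (t + 1) := by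
  have hmu : 0 ≤ mu S := (hS _ _).trans (diag_le_mu hS (p 0))
  have hprod : (∏ s ∈ Finset.range t, S (p s) (p (s + 1))) * S (p t) (p 0) =
      ∏ s : Fin (t + 1), S (p s) (p (s + 1 : Fin (t + 1))) := by
    rw [Fin.prod_univ_castSucc, Finset.prod_range]
    simp [Fin.coeSucc_eq_succ]
  rw [hprod]
  by_cases hpos : ∀ s : Fin (t + 1), 0 < S (p s) (p (s + 1 : Fin (t + 1)))
  · have hc : IsCycle S (fun s : Fin (t + 1) => p s) :=
      ⟨fun a b hab => Fin.ext (hp (by simp; omega) (by simp; omega) hab), hpos⟩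
    rw [← cycleMean_pow hc]
    exact pow_le_pow_left₀ (cycleMean_pos hc).le ((cycleMean_le_mu hS hc).trans hr) _
  · push Not at hpos
    obtain ⟨s, hs⟩ := hpos
    rw [Finset.prod_eq_zero (Finset.mem_univ s) (le_antisymm hs (hS _ _))]
    exact pow_nonneg (hmu.trans hr) _

/-- The weights, normalised by `r`, of the simple paths starting at `i`. -/
def pathWeights (S : Matrix (Fin n) (Fin n) ℝ) (r : ℝ) (i : Fin n) : Set ℝ :=
  {w | ∃ (k : ℕ) (p : ℕ → Fin n), p 0 = i ∧ Set.InjOn p (Set.Iic k) ∧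
    w = ∏ s ∈ Finset.range k, S (p s) (p (s + 1)) / r}

lemma one_mem_pathWeights (i : Fin n) : 1 ∈ pathWeights S r i :=
  ⟨0, fun _ => i, rfl, fun a ha b hb _ => by simp_all, by simp⟩

lemma bddAbove_pathWeights (hS : ∀ i j, 0 ≤ S i j) (hr : 0 < r) (i : Fin n) :
    BddAbove (pathWeights S r i) := by
  obtain ⟨M, hM, hs⟩ := exists_isSubeigenvector_one hS
  refine ⟨(max 1 (M / r)) ^ n, ?_⟩
  rintro _ ⟨k, p, -, hp, rfl⟩
  have hk : k ≤ n := by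
    have hinj : Function.Injective (fun s : Fin (k + 1) => p s) :=
      fun a b hab => Fin.ext (hp (by simp; omega) (by simp; omega) hab)
    have := Fintype.card_le_of_injective _ hinj
    simp only [Fintype.card_fin] at this
    omega
  calc ∏ s ∈ Finset.range k, S (p s) (p (s + 1)) / r
      ≤ ∏ s ∈ Finset.range k, max 1 (M / r) := by
        refine Finset.prod_le_prod (fun s _ => div_nonneg (hS _ _) hr.le) fun s _ => ?_
        refine le_max_of_le_right (div_le_div_of_nonneg_right ?_ hr.le)
        simpa using hs (p s) (p (s + 1))
    _ = max 1 (M / r) ^ k := by simp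
    _ ≤ _ := pow_le_pow_right₀ (le_max_left _ _) hk

/-- A nonnegative matrix has a positive subeigenvector for every positive `r ≥ μ(S)`. -/
lemma exists_pos_isSubeigenvector (hS : ∀ i j, 0 ≤ S i j) (hr : 0 < r) (hmu : mu S ≤ r) :
    ∃ x : Fin n → ℝ, (∀ i, 0 < x i) ∧ IsSubeigenvector S r x := by
  have hbdd := bddAbove_pathWeights (r := r) hS hr
  have hpos : ∀ i, 0 < sSup (pathWeights S r i) := fun i =>
    one_pos.trans_le (le_csSup (hbdd i) (one_mem_pathWeights i))
  refine ⟨fun i => sSup (pathWeights S r i), hpos, fun i j => ?_⟩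
  rcases (hS i j).eq_or_lt with h0 | hij
  · rw [← h0, zero_mul]
    exact mul_nonneg hr.le (hpos i).le
  rw [mul_comm, ← le_div_iff₀ hij]
  refine csSup_le ⟨1, one_mem_pathWeights j⟩ ?_
  rintro w ⟨k, p, rfl, hp, rfl⟩
  rw [le_div_iff₀ hij, mul_comm, ← div_le_iff₀' hr, mul_div_right_comm]
  -- Prepend the edge `(i, p 0)`. If the path already visits `i`, this closes a cycle of normalised
  -- weight at most `1`; discarding it leaves a simple path from `i` that is no lighter.
  by_cases hi : ∃ t ≤ k, p t = i
  · obtain ⟨t, htk, rfl⟩ := hi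
    have hcyc : (∏ s ∈ Finset.range t, S (p s) (p (s + 1)) / r) * (S (p t) (p 0) / r) ≤ 1 := by
      have := prod_simple_closed_walk_le hS hmu
        (hp.mono (Set.Iic_subset_Iic.2 htk))
      rw [Finset.prod_div_distrib, Finset.prod_const, Finset.card_range, div_mul_div_comm,
        ← pow_succ]
      exact (div_le_one (pow_pos hr _)).2 this
    have hmem : ∏ s ∈ Finset.range (k - t), S (p (t + s)) (p (t + s + 1)) / r ∈
        pathWeights S r (p t) := by
      refine ⟨k - t, fun s => p (t + s), rfl, fun a ha b hb hab => ?_, rfl⟩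
      simp only [Set.mem_Iic] at ha hb
      have := hp (x₁ := t + a) (x₂ := t + b) (by simp; omega) (by simp; omega) hab
      omega
    have hsplit := Finset.prod_range_add (fun s => S (p s) (p (s + 1)) / r) t (k - t)
    rw [Nat.add_sub_of_le htk] at hsplit
    rw [hsplit]
    refine le_trans ?_ (le_csSup (hbdd _) hmem)
    rw [← mul_assoc, mul_comm (S (p t) (p 0) / r)]
    refine mul_le_of_le_one_left (Finset.prod_nonneg fun s _ => div_nonneg (hS _ _) hr.le) hcyc
  -- Otherwise the extended path is itself simple.
  · push Not at hi
    refine le_csSup (hbdd _) ⟨k + 1, fun s => Nat.casesOn s i p, rfl, ?_, ?_⟩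
    · rintro (_ | a) ha (_ | b) hb hab
      · rfl
      · exact absurd hab.symm (hi b (by simpa using hb))
      · exact absurd hab (hi a (by simpa using ha))
      · rw [hp (by simpa using ha) (by simpa using hb) hab]
    · rw [Finset.prod_range_succ', mul_comm]
      rfl

end Existence

/-! ### Max-products of words in the matrices -/

section GeneralisedSpectralRadius

variable {n m : ℕ} {A : Fin m → Matrix (Fin n) (Fin n) ℝ} {r : ℝ} {x : Fin n → ℝ}

lemma le_maxMul (B C : Matrix (Fin n) (Fin n) ℝ) (i k j : Fin n) :
    B i k * C k j ≤ maxMul B C i j :=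
  le_ciSup (f := fun k => B i k * C k j) (Set.finite_range _).bddAbove k

lemma maxProd_nonneg (hA : ∀ l i j, 0 ≤ A l i j) (L : List (Fin m)) (i j : Fin n) :
    0 ≤ maxProd (L.map A) i j := by
  induction L generalizing i j with
  | nil =>
    simp only [maxProd, List.map_nil, List.foldr_nil, Matrix.one_apply]
    split_ifs <;> norm_num
  | cons l L ih =>
    exact Real.iSup_nonneg fun k => mul_nonneg (hA l i k) (ih k j)

lemma IsSubeigenvector.maxProd (hA : ∀ l i j, 0 ≤ A l i j)
    (hs : ∀ l, IsSubeigenvector (A l) r x) (hr : 0 ≤ r) (hx : ∀ i, 0 < x i) (L : List (Fin m)) :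
    IsSubeigenvector (maxProd (L.map A)) (r ^ L.length) x := by
  induction L with
  | nil =>
    intro i j
    simp only [MaxAlg.maxProd, List.map_nil, List.foldr_nil, Matrix.one_apply, List.length_nil,
      pow_zero, one_mul]
    split_ifs with h
    · simp [h]
    · simpa using (hx i).le
  | cons l L ih =>
    intro i j
    have : Nonempty (Fin n) := ⟨i⟩
    obtain ⟨k, hk⟩ := exists_eq_ciSup_of_finite
      (f := fun k => A l i k * MaxAlg.maxProd (L.map A) k j)
    have hk' : MaxAlg.maxProd ((l :: L).map A) i j = A l i k * MaxAlg.maxProd (L.map A) k j :=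
      hk.symm
    rw [hk', List.length_cons, mul_assoc]
    calc A l i k * (MaxAlg.maxProd (L.map A) k j * x j)
        ≤ A l i k * (r ^ L.length * x k) := mul_le_mul_of_nonneg_left (ih k j) (hA l i k)
      _ = r ^ L.length * (A l i k * x k) := by ring
      _ ≤ r ^ L.length * (r * x i) := mul_le_mul_of_nonneg_left (hs l i k) (pow_nonneg hr _)
      _ = _ := by ring

/-- An entry of the product dominates the weight of the given walk, which telescopes because every
step is tight. -/
lemma pow_mul_le_maxProd (hA : ∀ l i j, 0 ≤ A l i j) (hx : ∀ i, 0 < x i) (p : ℕ) (l : ℕ → Fin m)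
    (w : ℕ → Fin n) (h : ∀ t, A (l t) (w t) (w (t + 1)) * x (w (t + 1)) = r * x (w t)) :
    r ^ p * x (w 0) ≤ maxProd ((List.ofFn fun t : Fin p => l t).map A) (w 0) (w p) * x (w p) := by
  induction p generalizing l w with
  | zero => simp [maxProd]
  | succ p ih =>
    have ih' := ih (fun t => l (t + 1)) (fun t => w (t + 1)) fun t => h (t + 1)
    rw [List.ofFn_succ, List.map_cons]
    have hmul := le_maxMul (A (l 0)) (maxProd ((List.ofFn fun t : Fin p => l (t + 1)).map A))
      (w 0) (w 1) (w (p + 1))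
    calc r ^ (p + 1) * x (w 0) = r ^ p * (r * x (w 0)) := by ring
      _ = A (l 0) (w 0) (w 1) * (r ^ p * x (w 1)) := by rw [← h 0]; ring
      _ ≤ A (l 0) (w 0) (w 1) * _ := mul_le_mul_of_nonneg_left ih' (hA _ _ _)
      _ ≤ _ := by
        rw [← mul_assoc]
        exact mul_le_mul_of_nonneg_right hmul (hx _).le

end GeneralisedSpectralRadius


/-! ### The generalised spectral radius and uniqueness -/

section Main

variable {n m : ℕ} {A : Fin m → Matrix (Fin n) (Fin n) ℝ} {r : ℝ} {x : Fin n → ℝ}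

/-- `μ̂(Ψ) = μ(S)` as soon as `S` has a positive subeigenvector for `μ(S)` and a critical cycle. -/
lemma muHat_eq_mu [Nonempty (Fin m)] (hA : ∀ l i j, 0 ≤ A l i j) (hx : ∀ i, 0 < x i)
    (hs : IsSubeigenvector (maxSum A) (mu (maxSum A)) x) (hr : 0 < mu (maxSum A))
    {k : ℕ} {c : Fin (k + 1) → Fin n} (hc : IsCriticalCycle (maxSum A) c) :
    muHat A = mu (maxSum A) := by
  set r := mu (maxSum A) with hrdef
  have hmap : ∀ (p : ℕ) (j : Fin p → Fin m),
      maxProd (List.ofFn fun t => A (j t)) = maxProd ((List.ofFn j).map A) := by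
    intro p j
    rw [List.map_ofFn]
    rfl
  have hle : ∀ (p : ℕ) (j : Fin p → Fin m),
      mu (maxProd (List.ofFn fun t => A (j t))) ≤ r ^ p := by
    intro p j
    have h := IsSubeigenvector.maxProd hA ((isSubeigenvector_maxSum_iff hx).1 hs) hr.le hx
      (List.ofFn j)
    rw [List.length_ofFn] at h
    rw [hmap]
    exact h.mu_le hx (pow_nonneg hr.le _)
  have hnonneg : ∀ (p : ℕ) (j : Fin p → Fin m),
      0 ≤ mu (maxProd (List.ofFn fun t => A (j t))) := by
    intro p j
    rw [hmap]
    exact (maxProd_nonneg hA _ (c 0) (c 0)).trans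
      (diag_le_mu (fun i j => maxProd_nonneg hA _ i j) _)
  have hbdd : ∀ p : ℕ, BddAbove (Set.range fun j : Fin p → Fin m =>
      mu (maxProd (List.ofFn fun t => A (j t)))) := fun p => (Set.finite_range _).bddAbove
  set u : ℕ → ℝ := fun p =>
    (⨆ j : Fin p → Fin m, mu (maxProd (List.ofFn fun t => A (j t)))) ^ (1 / (p : ℝ)) with hu
  have hu0 : ∀ p, 0 ≤ u p := fun p =>
    Real.rpow_nonneg (Real.iSup_nonneg fun j => hnonneg p j) _
  -- At `p = 0` the exponent `1 / 0` is `0`, so `u 0 = 1` and the bound may fail.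
  have hupper : ∀ p ≠ 0, u p ≤ r := by
    intro p hp
    calc u p ≤ (r ^ p) ^ (1 / (p : ℝ)) :=
          Real.rpow_le_rpow (Real.iSup_nonneg fun j => hnonneg p j) (ciSup_le fun j => hle p j)
            (by positivity)
      _ = r := by rw [one_div, Real.pow_rpow_inv_natCast hr.le hp]
  have hupper' : ∀ᶠ p in atTop, u p ≤ r := by
    filter_upwards [eventually_ne_atTop 0] with p hp using hupper p hp
  -- Choosing a matrix that attains the maximum on each critical edge gives a periodic word that
  -- follows the cycle tightly.
  choose l hl using fun t : Fin (k + 1) => exists_eq_maxSum A (c t) (c (t + 1))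
  have htight : ∀ t : ℕ, A (l (Fin.ofNat (k + 1) t)) (c (Fin.ofNat (k + 1) t))
      (c (Fin.ofNat (k + 1) (t + 1))) * x (c (Fin.ofNat (k + 1) (t + 1))) =
      r * x (c (Fin.ofNat (k + 1) t)) := by
    intro t
    have hsucc : Fin.ofNat (k + 1) (t + 1) = Fin.ofNat (k + 1) t + 1 := by
      ext
      simp [Fin.val_add]
    rw [hsucc, hl]
    exact hs.eq_of_isCriticalEdge hx ⟨k, c, hc, _, rfl, rfl⟩
  -- Whole turns return to the start, so a diagonal entry bounds `mu` from below; multiples of the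
  -- cycle length suffice for a limsup.
  have hlower : ∀ q ≠ 0, r ≤ u ((k + 1) * q) := by
    intro q hq
    have hp : (k + 1) * q ≠ 0 := Nat.mul_ne_zero (Nat.succ_ne_zero k) hq
    have h := pow_mul_le_maxProd hA hx ((k + 1) * q) (fun t => l (Fin.ofNat (k + 1) t))
      (fun t => c (Fin.ofNat (k + 1) t)) htight
    have hw : c (Fin.ofNat (k + 1) ((k + 1) * q)) = c (Fin.ofNat (k + 1) 0) := by
      congr 1
      ext
      simp
    rw [hw] at h
    have h₂ := (le_of_mul_le_mul_right h (hx _)).trans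
      (diag_le_mu (fun i j => maxProd_nonneg hA _ i j) _)
    rw [← hmap] at h₂
    calc r = (r ^ ((k + 1) * q)) ^ (1 / (((k + 1) * q : ℕ) : ℝ)) := by
          rw [one_div, Real.pow_rpow_inv_natCast hr.le hp]
      _ ≤ _ := Real.rpow_le_rpow (pow_nonneg hr.le _)
          (h₂.trans (le_ciSup (hbdd _) _)) (by positivity)
  refine le_antisymm (limsup_le_of_le ?_ hupper') (le_limsup_of_frequently_le ?_ ?_)
  · exact IsCoboundedUnder.of_frequently_ge (a := 0) (Frequently.of_forall hu0)
  · rw [frequently_atTop]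
    intro a
    exact ⟨(k + 1) * (a + 1), by nlinarith, hlower _ (Nat.succ_ne_zero a)⟩
  · exact ⟨r, hupper'⟩

lemma exists_setD_eq_singleton [NeZero n] [Nonempty (Fin m)] (hA : ∀ l i j, 0 ≤ A l i j)
    (hirr : IsIrred (criticalMatrix (maxSum A))) (huniv : criticalNodes (maxSum A) = Set.univ) :
    ∃ x, setD A (muHat A) = {x} := by
  have hS : ∀ i j, 0 ≤ maxSum A i j := fun i j =>
    (hA (Classical.arbitrary _) i j).trans (le_maxSum A _ i j)
  have hnode : ∀ i, i ∈ criticalNodes (maxSum A) := fun i => huniv ▸ Set.mem_univ i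
  obtain ⟨k, c, hc, -⟩ := hnode 0
  have hr : 0 < mu (maxSum A) := hc.2 ▸ cycleMean_pos hc.1
  obtain ⟨x, hx, hs⟩ := exists_pos_isSubeigenvector hS hr le_rfl
  rw [muHat_eq_mu hA hx hs hr hc]
  -- Critical edges are tight for both `x` and `y`, so `y / x` is constant along them.
  have hratio : ∀ y : Fin n → ℝ, (∀ i, 0 < y i) →
      IsSubeigenvector (maxSum A) (mu (maxSum A)) y → ∀ j, y j / x j = y 0 / x 0 := by
    intro y hy hys j
    have h := hirr ⟨0, hnode 0⟩ ⟨j, hnode j⟩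
    generalize hj : (⟨j, hnode j⟩ : criticalNodes (maxSum A)) = j' at h
    have hj' : (j' : Fin n) = j := by rw [← hj]
    rw [← hj']
    clear hj hj'
    induction h with
    | refl => rfl
    | @tail a b _ hab ih =>
      rw [← ih]
      have hedge : IsCriticalEdge (maxSum A) a b := by
        by_contra hne
        simp [criticalMatrix, hne] at hab
      have hpos : 0 < maxSum A a b := by simpa [criticalMatrix, hedge] using hab
      have h₁ := hs.eq_of_isCriticalEdge hx hedge
      have h₂ := hys.eq_of_isCriticalEdge hy hedge
      rw [div_eq_div_iff (hx _).ne' (hx _).ne']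
      refine mul_left_cancel₀ (mul_pos hr hpos).ne' ?_
      linear_combination (mu (maxSum A)) * x a * h₂ - (mu (maxSum A)) * y a * h₁
  refine ⟨fun i => (x 0)⁻¹ * x i, Set.eq_singleton_iff_unique_mem.2 ⟨⟨?_, ?_⟩, ?_⟩⟩
  · rw [mem_setC_iff_maxSum]
    exact ⟨fun i => mul_pos (inv_pos.2 (hx 0)) (hx i), hs.smul (inv_pos.2 (hx 0)).le⟩
  · exact inv_mul_cancel₀ (hx 0).ne'
  · rintro y ⟨hy, hy0⟩
    rw [mem_setC_iff_maxSum] at hy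
    ext j
    have := hratio y hy.1 hy.2 j
    rw [hy0, div_eq_iff (hx j).ne', one_div] at this
    exact this

/-- If a positive subeigenvector is unique up to scaling, its tight edges form a strongly
connected digraph. -/
lemma IsSubeigenvector.tight_connected {S : Matrix (Fin n) (Fin n) ℝ}
    (hs : IsSubeigenvector S r x) (hx : ∀ i, 0 < x i) (hr : 0 ≤ r)
    (huniq : ∀ y : Fin n → ℝ, (∀ i, 0 < y i) → IsSubeigenvector S r y →
      ∃ a : ℝ, ∀ i, y i = a * x i) (i j : Fin n) :
    Relation.ReflTransGen (fun a b => S a b * x b = r * x a) i j := by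
  classical
  by_contra hij
  set R := Relation.ReflTransGen (fun a b => S a b * x b = r * x a) i with hR
  -- Edges leaving the set reachable from `i` are slack, so the coordinates outside it can all be
  -- scaled by some `d > 1`, contradicting uniqueness.
  have hev : ∀ a b, R a → ¬ R b → ∀ᶠ d : ℝ in 𝓝[>] 1, S a b * (d * x b) ≤ r * x a := by
    intro a b ha hb
    have hlt : S a b * (1 * x b) < r * x a := by
      rw [one_mul]
      exact lt_of_le_of_ne (hs a b) fun h => hb (ha.tail h)
    have hcont : ContinuousAt (fun d : ℝ => S a b * (d * x b)) 1 := by fun_prop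
    exact ((hcont.tendsto.eventually (gt_mem_nhds hlt)).filter_mono nhdsWithin_le_nhds).mono
      fun d hd => le_of_lt hd
  have hall : ∀ᶠ d : ℝ in 𝓝[>] 1, ∀ a b, R a → ¬ R b → S a b * (d * x b) ≤ r * x a := by
    simpa only [eventually_all] using hev
  obtain ⟨d, hd, hd1⟩ := (hall.and self_mem_nhdsWithin).exists
  have hd1 : 1 < d := hd1
  have hpos : ∀ a, 0 < if R a then x a else d * x a := by
    intro a
    split_ifs
    · exact hx a
    · exact mul_pos (by linarith) (hx a)
  obtain ⟨e, he⟩ := huniq (fun a => if R a then x a else d * x a) hpos (by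
    intro a b
    by_cases ha : R a <;> by_cases hb : R b <;> simp only [ha, hb, if_true, if_false]
    · exact hs a b
    · exact hd a b ha hb
    · refine (hs a b).trans (mul_le_mul_of_nonneg_left ?_ hr)
      exact le_mul_of_one_le_left (hx a).le hd1.le
    · have := mul_le_mul_of_nonneg_left (hs a b) (zero_le_one.trans hd1.le)
      linarith)
  have h₁ := he i
  have h₂ := he j
  rw [if_pos Relation.ReflTransGen.refl] at h₁
  rw [if_neg hij] at h₂
  have e₁ : e = 1 := mul_right_cancel₀ (hx i).ne' (by linarith)
  have e₂ : d = e := mul_right_cancel₀ (hx j).ne' h₂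
  linarith

/-- The level `r` is arbitrary: uniqueness at any level forces the conclusion. -/
lemma irred_of_setD_eq_singleton [NeZero n] [Nonempty (Fin m)] (hA : ∀ l i j, 0 ≤ A l i j)
    (hne : ∃ l, A l ≠ 0) (h : ∃ x, setD A r = {x}) :
    IsIrred (criticalMatrix (maxSum A)) ∧ criticalNodes (maxSum A) = Set.univ := by
  have hS : ∀ i j, 0 ≤ maxSum A i j := fun i j =>
    (hA (Classical.arbitrary _) i j).trans (le_maxSum A _ i j)
  have hpos : ∃ i j, 0 < maxSum A i j := by
    obtain ⟨l, hl⟩ := hne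
    by_contra! hcon
    exact hl (Matrix.ext fun i j => le_antisymm ((le_maxSum A l i j).trans (hcon i j)) (hA l i j))
  obtain ⟨i₀, j₀, hpos⟩ := hpos
  -- For `n = 1` the normalisation alone gives uniqueness and the loop need not be tight at level
  -- `r`, so its own weight serves as the level.
  rcases subsingleton_or_nontrivial (Fin n) with hn | hn
  · have hd : ∀ i j, maxSum A i j = maxSum A i₀ j₀ := fun i j => by
      rw [Subsingleton.elim i i₀, Subsingleton.elim j j₀]
    refine IsSubeigenvector.irred_criticalMatrix (r := maxSum A i₀ j₀) (x := fun _ => 1) hS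
      (fun i j => by rw [hd]) (fun _ => one_pos) hpos (fun i j => ?_) fun i => ⟨i, by rw [hd]⟩
    rw [Subsingleton.elim i j]
  · obtain ⟨x, hx⟩ := h
    have hxm : x ∈ setD A r := hx ▸ Set.mem_singleton x
    obtain ⟨hxp, hs⟩ := mem_setC_iff_maxSum.1 hxm.1
    have hr : 0 < r := by
      refine pos_of_mul_pos_left ?_ (hxp i₀).le
      exact (mul_pos hpos (hxp j₀)).trans_le (hs i₀ j₀)
    have hconn := hs.tight_connected hxp hr.le fun y hy hys => by
      refine ⟨y 0, fun i => ?_⟩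
      have hmem : (fun i => (y 0)⁻¹ * y i) ∈ setD A r :=
        ⟨mem_setC_iff_maxSum.2 ⟨fun i => mul_pos (inv_pos.2 (hy 0)) (hy i),
          hys.smul (inv_pos.2 (hy 0)).le⟩, inv_mul_cancel₀ (hy 0).ne'⟩
      rw [hx, Set.mem_singleton_iff] at hmem
      rw [← hmem, mul_inv_cancel_left₀ (hy 0).ne']
    refine hs.irred_criticalMatrix hS hxp hr hconn fun i => ?_
    -- A tight path from `i` to another node begins with a tight edge out of `i`.
    obtain ⟨j, hj⟩ := exists_ne i
    rcases (hconn i j).cases_head with h | ⟨b, hb, -⟩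
    · exact absurd h.symm hj
    · exact ⟨b, hb⟩

end Main

end MaxAlg

theorem mainTheorem7 {n m : ℕ} [NeZero n] (A : Fin m → Matrix (Fin n) (Fin n) ℝ)
    (hA : ∀ l i j, 0 ≤ A l i j) (hne : ∃ l, A l ≠ 0) :
    (∀ r : ℝ,
      (Convex ℝ (MaxAlg.setC A r) ∧ MaxAlg.MaxConvex (MaxAlg.setC A r)) ∧
      (Convex ℝ (MaxAlg.setD A r) ∧ MaxAlg.MaxConvex (MaxAlg.setD A r))) ∧
    ((∃ x, MaxAlg.setD A (MaxAlg.muHat A) = {x}) ↔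
      MaxAlg.IsIrred (MaxAlg.criticalMatrix (MaxAlg.maxSum A)) ∧
        MaxAlg.criticalNodes (MaxAlg.maxSum A) = Set.univ) ∧
    ((∀ l, MaxAlg.IsIrred (A l)) → ∀ r : ℝ, IsCompact (MaxAlg.setD A r)) := by
  obtain ⟨l, -⟩ := id hne
  have : Nonempty (Fin m) := ⟨l⟩
  exact ⟨fun r => ⟨⟨MaxAlg.convex_setC A r, MaxAlg.maxConvex_setC hA r⟩,
      MaxAlg.convex_setD A r, MaxAlg.maxConvex_setD hA r⟩,
    ⟨MaxAlg.irred_of_setD_eq_singleton hA hne,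
      fun h => MaxAlg.exists_setD_eq_singleton hA h.1 h.2⟩,
    fun hirr r => MaxAlg.isCompact_setD (hirr l) r⟩
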